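/- For $n\ge 1$ let $X_1,\dots,X_n$ be independent half-normal random variables, i.e. with density $\sqrt{2/\pi}\,e^{-x^2/2}$ on $x>0$, and let $\mu_n=\mathbb{E}\bigl(\max\{X_1,\dots,X_n\}\bigr)$. Let $C_n\subset\mathbb{R}^n$ be the regular $n$-crosspolytope with edges of unit length (the convex hull of the points $\pm e_i/\sqrt2$, $1\le i\le n$). The width of a convex body in the direction of a unit vector $u$ is the distance between its two supporting hyperplanes orthogonal to $u$; the mean width is the average of the width over $u$ uniformly distributed on the unit sphere. Let $\mathbb{E}(w_n)$ be the mean width of $C_n$, let $r_n$ be the inradius of $C_n$ (the largest radius of a ball contained in $C_n$), and let $\mathbb{E}(\widehat w_n)$ be the mean width of the rescaled crosspolytope $r_n^{-1}C_n$, which has inradius $1$. Let $\gamma$ be the Euler--Mascheroni constant. Then, as $n\to\infty$, $$\mu_n=\sqrt{2\ln n}-\frac{\ln\ln n+\ln\pi-2\gamma}{2\sqrt{2\ln n}}+o\!\left(\frac1{\sqrt{\ln n}}\right),$$ $$\mathbb{E}(w_n)=2\sqrt{\frac{\ln n}{n}}-\frac{\ln\ln n+\ln\pi-2\gamma}{2\sqrt{n\ln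 n}}+o\!\left(\frac1{\sqrt{n\ln n}}\right),$$ and $\mathbb{E}(\widehat w_n)\sim 2\sqrt{2\ln n}$, meaning that the ratio of the two sides tends to $1$. -/

import Mathlib

open MeasureTheory Asymptotics Filter
open scoped Pointwise

noncomputable section

/-- The half-normal law: density `√(2/π) exp (-x²/2)` on `x > 0`, and `0` elsewhere. -/
def halfNormal : Measure ℝ :=
  volume.withDensity fun x =>
    if 0 < x then ENNReal.ofReal (Real.sqrt (2 / Real.pi) * Real.exp (-x ^ 2 / 2)) else 0

/-- The expected maximum `μ_n` of a random sample `X_1, …, X_n` of size `n` from the half-normal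
law (a sample is a point of `ℝⁿ` distributed according to the `n`-fold product law). -/
def halfNormalMaxMean (n : ℕ) : ℝ :=
  ∫ x : Fin n → ℝ, ⨆ i, x i ∂(Measure.pi fun _ : Fin n => halfNormal)

/-- The regular `n`-cross-polytope with edge length `l`, centred at the origin: the convex hull of
the `2n` points `± (l / √2) e_i`. The edges join the vertices `± (l / √2) e_i` and
`± (l / √2) e_j` with `i ≠ j`, and have length `l`. -/
def crossPolytope (n : ℕ) (l : ℝ) : Set (EuclideanSpace ℝ (Fin n)) :=
  convexHull ℝ {v | ∃ i : Fin n,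
    v = (l / Real.sqrt 2) • EuclideanSpace.single i (1 : ℝ) ∨
    v = -((l / Real.sqrt 2) • EuclideanSpace.single i (1 : ℝ))}

/-- The width of `C` in the direction of the unit vector `u`: the distance between the two
supporting hyperplanes `⟪u, x⟫ = sup_C ⟪u, ·⟫` and `⟪u, x⟫ = inf_C ⟪u, ·⟫` orthogonal to `u`. -/
def width {n : ℕ} (C : Set (EuclideanSpace ℝ (Fin n))) (u : EuclideanSpace ℝ (Fin n)) : ℝ :=
  sSup ((fun x => inner ℝ u x) '' C) - sInf ((fun x => inner ℝ u x) '' C)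

/-- The mean width: the average of the width over the unit sphere, with respect to the uniform
(normalized surface) measure. -/
def meanWidth {n : ℕ} (C : Set (EuclideanSpace ℝ (Fin n))) : ℝ :=
  ⨍ u : Metric.sphere (0 : EuclideanSpace ℝ (Fin n)) 1, width C u
    ∂(volume : Measure (EuclideanSpace ℝ (Fin n))).toSphere

/-- The inradius: the largest radius of a ball contained in `C`. -/
def inradius {n : ℕ} (C : Set (EuclideanSpace ℝ (Fin n))) : ℝ :=
  sSup {r : ℝ | 0 ≤ r ∧ ∃ c, Metric.closedBall c r ⊆ C}

end

/-! Let G be a standard Gaussian vector in ℝⁿ, so that μ_n is the mean of max |G_i|. Put b = √(2 ln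
n), d = (ln ln n + ln π)/2 and a = b − d/b. Mills' bounds for the half-normal survival function Q
give n Q(a + x/b) → e^{-x}, so b (max |G_i| − a) converges in law to the Gumbel distribution. A
bound by 2 e^{-|x|/8}, valid for all large n, lets the means converge as well: b (μ_n − a) tends to
the Gumbel mean (`tendsto_maxScale_mul_halfNormalMaxMean_sub`), which is the first expansion. The
Gumbel mean is identified by running the same argument on exponential variables, whose maximum has
mean H_n and location ln n; hence it is lim (H_n − ln n) = γ (`integral_step_sub_gumbel`).

The width of C_n in direction u is √2 max |u_i|, homogeneous of degree one in u, so polar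
coordinates turn its spherical average into √2 μ_n / E‖G‖ (`average_sphere_iSup_abs`). Log-convexity
of Gamma gives √(n−1) ≤ E‖G‖ ≤ √n, so replacing E‖G‖ by √n costs a relative error O(1/n), negligible
at the required precision. The inradius is 1/√(2n), because C_n is an ℓ¹ ball; this yields the last
claim. -/

/-! ### The Gumbel distribution and its mean. -/

/-- The function `t ↦ exp (-c |t|)` is integrable. -/
lemma integrable_exp_neg_mul_abs_real {c : ℝ} (hc : 0 < c) :
    Integrable fun x : ℝ => Real.exp (-(c * |x|)) := by
  rw [← integrableOn_univ, ← Set.Iic_union_Ioi (a := (0 : ℝ))]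
  refine IntegrableOn.union ?_ ?_
  · refine (integrableOn_exp_mul_Iic hc 0).congr_fun (fun x hx => ?_) measurableSet_Iic
    simp [abs_of_nonpos (Set.mem_Iic.1 hx)]
  · refine (integrableOn_exp_mul_Ioi (a := -c) (by linarith) 0).congr_fun (fun x hx => ?_)
      measurableSet_Ioi
    simp [abs_of_pos (Set.mem_Ioi.1 hx)]

open Set in
/-- Dominated convergence for differences between the unit step and functions that converge to the
Gumbel distribution function. -/
lemma tendsto_integral_step_sub_gumbel {P : ℕ → ℝ → ℝ} {C c : ℝ} (hc : 0 < c)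
    (hmeas : ∀ n, Measurable (P n))
    (hbound : ∀ᶠ n in atTop, ∀ x,
      |(Ioi (0 : ℝ)).indicator 1 x - P n x| ≤ C * Real.exp (-(c * |x|)))
    (hlim : ∀ x, Tendsto (fun n => P n x) atTop (nhds (Real.exp (-Real.exp (-x))))) :
    Tendsto (fun n => ∫ x, ((Ioi (0 : ℝ)).indicator 1 x - P n x)) atTop
      (nhds (∫ x, ((Ioi (0 : ℝ)).indicator 1 x - Real.exp (-Real.exp (-x))))) := by
  refine tendsto_integral_filter_of_dominated_convergence
    (fun x => C * Real.exp (-(c * |x|))) ?_ ?_ ?_ ?_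
  · refine Eventually.of_forall fun n => Measurable.aestronglyMeasurable ?_
    exact (measurable_one.indicator measurableSet_Ioi).sub (hmeas n)
  · filter_upwards [hbound] with n hn
    exact Eventually.of_forall fun x => hn x
  · exact (integrable_exp_neg_mul_abs_real hc).const_mul C
  · exact Eventually.of_forall fun x => tendsto_const_nhds.sub (hlim x)

open Set in
/-- Effect of an affine change of variables on the integral of `1 - F`, where `F` is the
distribution function of a nonnegative random variable. -/
lemma integral_step_sub_comp_affine {F : ℝ → ℝ} (hF0 : ∀ t ≤ 0, F t = 0)
    (hF : IntegrableOn (fun t => 1 - F t) (Ioi 0)) {a b : ℝ} (ha : 0 ≤ a) (hb : 0 < b) :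
    ∫ x, ((Ioi (0 : ℝ)).indicator 1 x - F (a + x / b)) =
      b * ((∫ t in Ioi 0, (1 - F t)) - a) := by
  -- The step of the substituted function sits at x = -ab instead of 0; the correction is the
  -- indicator of (-ab, 0], which contributes the term -ab.
  have h1 : ∀ x : ℝ, (Ioi (0 : ℝ)).indicator 1 x - F (a + x / b) =
      (Ioi (0 : ℝ)).indicator (fun t => 1 - F t) (a + x / b) -
        (Ioc (-(a * b)) 0).indicator (fun _ => (1 : ℝ)) x := by
    intro x
    have e : 0 < a + x / b ↔ -(a * b) < x := by
      rw [show a + x / b = (a * b + x) / b by field_simp, lt_div_iff₀ hb, zero_mul]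
      constructor <;> intro h <;> linarith
    have hab : 0 ≤ a * b := by positivity
    by_cases hx : 0 < x
    · have : 0 < a + x / b := e.2 (by linarith)
      simp [indicator, hx, this, not_le.2 hx]
    · by_cases h : 0 < a + x / b
      · simp [indicator, hx, h, e.1 h, not_lt.1 hx]
      · have h' := not_lt.1 fun h' => h (e.2 h')
        simp [indicator, hx, h, not_lt.2 h', hF0 _ (not_lt.1 h)]
  have hG : Integrable ((Ioi (0 : ℝ)).indicator fun t => 1 - F t) :=
    (integrable_indicator_iff measurableSet_Ioi).2 hF
  simp_rw [h1]
  rw [integral_sub]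
  · rw [integral_indicator measurableSet_Ioc,
      Measure.integral_comp_div (fun y => (Ioi (0 : ℝ)).indicator (fun t => 1 - F t) (a + y)) b,
      integral_add_left_eq_self ((Ioi (0 : ℝ)).indicator fun t => 1 - F t) a,
      integral_indicator measurableSet_Ioi]
    have : 0 ≤ a * b := by positivity
    simp [abs_of_pos hb, this]
    ring
  · exact (hG.comp_add_left a).comp_div hb.ne'
  · exact (integrable_indicator_iff measurableSet_Ioc).2 (by simp)

open Set in
/-- The integral of `exp (-t) (1 - exp (-t)) ^ k` over the positive half-line. -/
lemma hasIntegral_exp_mul_one_sub_exp_pow (k : ℕ) :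
    IntegrableOn (fun t : ℝ => Real.exp (-t) * (1 - Real.exp (-t)) ^ k) (Ioi 0) ∧
    ∫ t in Ioi (0 : ℝ), Real.exp (-t) * (1 - Real.exp (-t)) ^ k = 1 / (k + 1) := by
  have hd : ∀ t : ℝ, HasDerivAt (fun t => (1 - Real.exp (-t)) ^ (k + 1) / (k + 1))
      (Real.exp (-t) * (1 - Real.exp (-t)) ^ k) t := by
    intro t
    refine ((((hasDerivAt_id t).neg.exp.const_sub 1).pow (k + 1)).div_const
      ((k : ℝ) + 1)).congr_deriv ?_
    have : (k : ℝ) + 1 ≠ 0 := by positivity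
    simp only [Pi.neg_apply, id, add_tsub_cancel_right]
    push_cast
    field_simp
  have hl : Tendsto (fun t : ℝ => (1 - Real.exp (-t)) ^ (k + 1) / (k + 1)) atTop
      (nhds (1 / (k + 1))) := by
    have : Tendsto (fun t : ℝ => Real.exp (-t)) atTop (nhds 0) :=
      Real.tendsto_exp_neg_atTop_nhds_zero
    simpa using ((this.const_sub 1).pow (k + 1)).div_const ((k : ℝ) + 1)
  have hp : ∀ t ∈ Ioi (0 : ℝ), 0 ≤ Real.exp (-t) * (1 - Real.exp (-t)) ^ k := by
    intro t ht
    have : Real.exp (-t) ≤ 1 := Real.exp_le_one_iff.2 (by linarith [mem_Ioi.1 ht])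
    exact mul_nonneg (Real.exp_pos _).le (pow_nonneg (by linarith) _)
  refine ⟨integrableOn_Ioi_deriv_of_nonneg' (fun t _ => hd t) hp hl, ?_⟩
  rw [integral_Ioi_of_hasDerivAt_of_nonneg' (fun t _ => hd t) hp hl]
  simp

open Set in
/-- The expected maximum of `n` independent standard exponential variables is the `n`-th harmonic
number. -/
lemma hasIntegral_one_sub_one_sub_exp_pow (n : ℕ) :
    IntegrableOn (fun t : ℝ => 1 - (1 - Real.exp (-t)) ^ n) (Ioi 0) ∧
    ∫ t in Ioi (0 : ℝ), (1 - (1 - Real.exp (-t)) ^ n) = harmonic n := by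
  have h : (fun t : ℝ => 1 - (1 - Real.exp (-t)) ^ n) =
      fun t => ∑ k ∈ Finset.range n, Real.exp (-t) * (1 - Real.exp (-t)) ^ k := by
    ext t
    have := mul_neg_geom_sum (1 - Real.exp (-t)) n
    rw [← this, Finset.mul_sum]
    simp
  rw [h]
  refine ⟨integrable_finsetSum _ fun k _ => (hasIntegral_exp_mul_one_sub_exp_pow k).1, ?_⟩
  rw [integral_finsetSum _ fun k _ => (hasIntegral_exp_mul_one_sub_exp_pow k).1]
  simp [(hasIntegral_exp_mul_one_sub_exp_pow _).2, harmonic]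

open Set in
/-- The mean of the Gumbel distribution is the Euler–Mascheroni constant. -/
lemma integral_step_sub_gumbel :
    ∫ x, ((Ioi (0 : ℝ)).indicator 1 x - Real.exp (-Real.exp (-x))) =
      Real.eulerMascheroniConstant := by
  let F : ℕ → ℝ → ℝ := fun n t => if 0 < t then (1 - Real.exp (-t)) ^ n else 0
  have hshift : ∀ n : ℕ, 1 ≤ n → ∀ x : ℝ,
      Real.exp (-(Real.log n + x / 1)) = Real.exp (-x) / n := by
    intro n hn x
    have : (0 : ℝ) < n := by exact_mod_cast hn
    rw [div_one, neg_add, Real.exp_add, Real.exp_neg, Real.exp_log this]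
    field_simp
  -- One sequence, two limits: dominated convergence gives the Gumbel integral, while exact
  -- evaluation gives H_n − log n, which tends to γ.
  refine tendsto_nhds_unique (f := fun n : ℕ => ∫ x, ((Ioi (0 : ℝ)).indicator 1 x -
    F n (Real.log n + x / 1))) (l := atTop) ?_ ?_
  · refine tendsto_integral_step_sub_gumbel (C := 1) one_pos ?_ ?_ ?_
    · intro n
      exact Measurable.ite (measurableSet_lt measurable_const (by fun_prop)) (by fun_prop)
        measurable_const
    · filter_upwards [eventually_ge_atTop 1] with n hn x
      have hn0 : (0 : ℝ) < n := by exact_mod_cast hn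
      have hlog : 0 ≤ Real.log n := Real.log_natCast_nonneg n
      simp only [F, hshift n hn]
      by_cases hx : 0 < x
      · have hpos : 0 < Real.log n + x / 1 := by simp; linarith
        have h1 : Real.exp (-x) / n ≤ 1 := by
          rw [← hshift n hn]; exact Real.exp_le_one_iff.2 (by linarith)
        have h0 : 0 ≤ Real.exp (-x) / n := by positivity
        have hb := one_add_mul_le_pow (a := -(Real.exp (-x) / n)) (by linarith) n
        have hle : (1 - Real.exp (-x) / n) ^ n ≤ 1 := pow_le_one₀ (by linarith) (by linarith)
        rw [if_pos hpos, indicator_of_mem (mem_Ioi.2 hx), Pi.one_apply, abs_of_nonneg (by linarith),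
          abs_of_pos hx, one_mul, one_mul]
        have : (n : ℝ) * -(Real.exp (-x) / n) = -Real.exp (-x) := by field_simp
        rw [this, ← sub_eq_add_neg, ← sub_eq_add_neg] at hb
        linarith
      · rw [indicator_of_notMem (by simpa using hx), zero_sub, abs_neg]
        split_ifs with h
        · have h1 : Real.exp (-x) / n ≤ 1 := by
            rw [← hshift n hn]; exact Real.exp_le_one_iff.2 (by linarith)
          rw [abs_of_nonneg (pow_nonneg (by linarith) _), abs_of_nonpos (not_lt.1 hx)]
          calc (1 - Real.exp (-x) / n) ^ n ≤ Real.exp (-(Real.exp (-x) / n)) ^ n := by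
                gcongr
                linarith [Real.add_one_le_exp (-(Real.exp (-x) / n))]
            _ = Real.exp (-Real.exp (-x)) := by
                rw [← Real.exp_nat_mul]; congr 1; field_simp
            _ ≤ _ := by
                rw [one_mul, one_mul]
                gcongr
                linarith [Real.add_one_le_exp (-x)]
        · simpa using (Real.exp_pos _).le
    · intro x
      have h1 : Tendsto (fun n : ℕ => (1 + -(Real.exp (-x)) / (n : ℝ)) ^ n) atTop
          (nhds (Real.exp (-Real.exp (-x)))) := Real.tendsto_one_add_div_pow_exp _
      refine h1.congr' ?_
      have h2 : ∀ᶠ n : ℕ in atTop, -x < Real.log n :=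
        (Real.tendsto_log_atTop.comp tendsto_natCast_atTop_atTop).eventually_gt_atTop (-x)
      filter_upwards [h2, eventually_ge_atTop 1] with n h2 hn
      simp only [F, hshift n hn]
      rw [if_pos (by simp; linarith)]
      ring
  · refine Real.tendsto_harmonic_sub_log.congr fun n => ?_
    have e : ∀ t ∈ Ioi (0 : ℝ), 1 - (1 - Real.exp (-t)) ^ n = 1 - F n t := by
      intro t ht
      simp [F, mem_Ioi.1 ht]
    rw [integral_step_sub_comp_affine (fun t ht => if_neg (not_lt.2 ht))
      ((hasIntegral_one_sub_one_sub_exp_pow n).1.congr_fun e measurableSet_Ioi)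
      (Real.log_natCast_nonneg n) one_pos, ← (hasIntegral_one_sub_one_sub_exp_pow n).2,
      setIntegral_congr_fun measurableSet_Ioi e, one_mul]

/-! ### Tail and distribution function of the half-normal law. -/

lemma integrable_exp_neg_sq_half : Integrable fun x : ℝ => Real.exp (-x ^ 2 / 2) := by
  refine (integrable_exp_neg_mul_sq (b := 1 / 2) (by norm_num)).congr
    (Eventually.of_forall fun x => ?_)
  show Real.exp _ = Real.exp _
  congr 1; ring

open Set in
lemma integral_exp_neg_sq_half_Ioi_zero :
    ∫ x in Ioi (0 : ℝ), Real.exp (-x ^ 2 / 2) = Real.sqrt (Real.pi / 2) := by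
  have h := integral_gaussian_Ioi (1 / 2)
  have e : ∀ x : ℝ, Real.exp (-(1 / 2) * x ^ 2) = Real.exp (-x ^ 2 / 2) := fun x => by
    congr 1; ring
  simp_rw [e] at h
  rw [h, show Real.pi / (1 / 2) = 2 ^ 2 * (Real.pi / 2) by ring, Real.sqrt_mul (by norm_num),
    Real.sqrt_sq (by norm_num)]
  ring

lemma hasDerivAt_exp_neg_sq_half (s : ℝ) :
    HasDerivAt (fun s => Real.exp (-s ^ 2 / 2)) (-s * Real.exp (-s ^ 2 / 2)) s := by
  refine (((hasDerivAt_pow 2 s).neg.div_const 2).exp).congr_deriv ?_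
  simp only [Pi.neg_apply]
  push_cast
  ring

lemma tendsto_exp_neg_sq_half :
    Tendsto (fun s : ℝ => Real.exp (-s ^ 2 / 2)) atTop (nhds 0) := by
  refine Real.tendsto_exp_atBot.comp ?_
  have : Tendsto (fun s : ℝ => s ^ 2 / 2) atTop atTop :=
    (tendsto_pow_atTop two_ne_zero).atTop_div_const two_pos
  refine (tendsto_neg_atTop_atBot.comp this).congr fun s => ?_
  simp [neg_div]

open Set in
/-- Upper bound for Mills' ratio. -/
lemma integral_exp_neg_sq_half_Ioi_le {t : ℝ} (ht : 0 < t) :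
    ∫ s in Ioi t, Real.exp (-s ^ 2 / 2) ≤ Real.exp (-t ^ 2 / 2) / t := by
  -- Inserting the factor s/t ≥ 1 makes the integrand an exact derivative.
  have hd : ∀ s ∈ Ici t, HasDerivAt (fun s => -Real.exp (-s ^ 2 / 2) / t)
      (s * Real.exp (-s ^ 2 / 2) / t) s := fun s _ =>
    ((hasDerivAt_exp_neg_sq_half s).neg.div_const t).congr_deriv (by ring)
  have hp : ∀ s ∈ Ioi t, 0 ≤ s * Real.exp (-s ^ 2 / 2) / t := fun s hs => by
    have : 0 < s := ht.trans hs
    positivity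
  have hl : Tendsto (fun s => -Real.exp (-s ^ 2 / 2) / t) atTop (nhds 0) := by
    simpa using tendsto_exp_neg_sq_half.neg.div_const t
  have hi := integral_Ioi_of_hasDerivAt_of_nonneg' hd hp hl
  calc _ ≤ ∫ s in Ioi t, s * Real.exp (-s ^ 2 / 2) / t := by
        refine setIntegral_mono_on integrable_exp_neg_sq_half.integrableOn
          (integrableOn_Ioi_deriv_of_nonneg' hd hp hl) measurableSet_Ioi fun s hs => ?_
        rw [le_div_iff₀ ht, mul_comm]
        exact mul_le_mul_of_nonneg_right (le_of_lt hs) (Real.exp_pos _).le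
    _ = _ := by rw [hi]; ring

open Set in
/-- Lower bound for Mills' ratio. -/
lemma le_integral_exp_neg_sq_half_Ioi {t : ℝ} (ht : 0 ≤ t) :
    Real.exp (-t ^ 2 / 2) / (1 + t) ≤ ∫ s in Ioi t, Real.exp (-s ^ 2 / 2) := by
  -- Here the inserted factor (s² + s + 1)/(1 + s)² is at most 1 for s ≥ 0.
  have hd : ∀ s ∈ Ici t, HasDerivAt (fun s => -(Real.exp (-s ^ 2 / 2) / (1 + s)))
      ((s ^ 2 + s + 1) / (1 + s) ^ 2 * Real.exp (-s ^ 2 / 2)) s := fun s hs => by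
    have h0 : (1 : ℝ) + s ≠ 0 := by linarith [mem_Ici.1 hs]
    refine ((hasDerivAt_exp_neg_sq_half s).div ((hasDerivAt_id s).const_add 1) h0).neg.congr_deriv
      ?_
    simp only [id]
    field_simp
    ring
  have hp : ∀ s ∈ Ioi t, 0 ≤ (s ^ 2 + s + 1) / (1 + s) ^ 2 * Real.exp (-s ^ 2 / 2) :=
    fun s hs => by
      have : 0 < s := ht.trans_lt hs
      positivity
  have hl : Tendsto (fun s : ℝ => -(Real.exp (-s ^ 2 / 2) / (1 + s))) atTop (nhds 0) := by
    simpa using (tendsto_exp_neg_sq_half.div_atTop (tendsto_atTop_add_const_left _ 1 tendsto_id)).neg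
  have hi := integral_Ioi_of_hasDerivAt_of_nonneg' hd hp hl
  calc _ = ∫ s in Ioi t, (s ^ 2 + s + 1) / (1 + s) ^ 2 * Real.exp (-s ^ 2 / 2) := by
        rw [hi]; ring
    _ ≤ _ := by
        refine setIntegral_mono_on (integrableOn_Ioi_deriv_of_nonneg' hd hp hl)
          integrable_exp_neg_sq_half.integrableOn measurableSet_Ioi fun s hs => ?_
        have : 0 < s := ht.trans_lt hs
        refine mul_le_of_le_one_left (Real.exp_pos _).le ?_
        rw [div_le_one (by positivity)]
        nlinarith

/-- The survival function of the half-normal law. -/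
noncomputable def halfNormalTail (t : ℝ) : ℝ :=
  Real.sqrt (2 / Real.pi) * ∫ s in Set.Ioi t, Real.exp (-s ^ 2 / 2)

lemma halfNormalTail_zero : halfNormalTail 0 = 1 := by
  rw [halfNormalTail, integral_exp_neg_sq_half_Ioi_zero, ← Real.sqrt_mul (by positivity)]
  have : Real.pi ≠ 0 := Real.pi_ne_zero
  rw [show 2 / Real.pi * (Real.pi / 2) = 1 by field_simp, Real.sqrt_one]

lemma halfNormalTail_nonneg (t : ℝ) : 0 ≤ halfNormalTail t :=
  mul_nonneg (Real.sqrt_nonneg _) (integral_nonneg fun _ => (Real.exp_pos _).le)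

lemma antitone_halfNormalTail : Antitone halfNormalTail := fun _ _ hst =>
  mul_le_mul_of_nonneg_left (setIntegral_mono_set integrable_exp_neg_sq_half.integrableOn
    (Eventually.of_forall fun _ => (Real.exp_pos _).le)
    (Set.Ioi_subset_Ioi hst).eventuallyLE) (Real.sqrt_nonneg _)

lemma halfNormalTail_le_one {t : ℝ} (ht : 0 ≤ t) : halfNormalTail t ≤ 1 :=
  halfNormalTail_zero ▸ antitone_halfNormalTail ht

open Set in
lemma halfNormal_Ioi {t : ℝ} (ht : 0 ≤ t) :
    halfNormal (Ioi t) = ENNReal.ofReal (halfNormalTail t) := by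
  rw [halfNormal, withDensity_apply _ measurableSet_Ioi, halfNormalTail, ← integral_const_mul,
    ofReal_integral_eq_lintegral_ofReal]
  · refine setLIntegral_congr_fun measurableSet_Ioi fun x hx => ?_
    exact if_pos (ht.trans_lt hx)
  · exact (integrable_exp_neg_sq_half.const_mul _).integrableOn
  · exact Eventually.of_forall fun x => mul_nonneg (Real.sqrt_nonneg _) (Real.exp_pos _).le

open Set in
lemma halfNormal_Iic_zero : halfNormal (Iic 0) = 0 := by
  rw [halfNormal, withDensity_apply _ measurableSet_Iic, setLIntegral_congr_fun measurableSet_Iic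
    (g := fun _ => 0) fun x hx => if_neg (not_lt.2 hx)]
  simp

instance : IsProbabilityMeasure halfNormal := by
  refine ⟨?_⟩
  rw [← Set.Iic_union_Ioi (a := (0 : ℝ)), measure_union (by simp) measurableSet_Ioi,
    halfNormal_Iic_zero, halfNormal_Ioi le_rfl, halfNormalTail_zero]
  simp

/-- The distribution function of the half-normal law. -/
noncomputable def halfNormalCDF (t : ℝ) : ℝ :=
  if 0 < t then 1 - halfNormalTail t else 0

open Set in
lemma halfNormal_real_Iic (t : ℝ) : halfNormal.real (Iic t) = halfNormalCDF t := by
  rw [halfNormalCDF]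
  split_ifs with h
  · rw [← compl_Ioi, probReal_compl_eq_one_sub measurableSet_Ioi, measureReal_def,
      halfNormal_Ioi h.le, ENNReal.toReal_ofReal (halfNormalTail_nonneg t)]
  · rw [measureReal_def, measure_mono_null (Iic_subset_Iic.2 (not_lt.1 h)) halfNormal_Iic_zero]
    simp

lemma halfNormalCDF_nonneg (t : ℝ) : 0 ≤ halfNormalCDF t :=
  halfNormal_real_Iic t ▸ measureReal_nonneg

lemma halfNormalCDF_le_one (t : ℝ) : halfNormalCDF t ≤ 1 :=
  halfNormal_real_Iic t ▸ measureReal_le_one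

lemma monotone_halfNormalCDF : Monotone halfNormalCDF := fun s t hst => by
  rw [← halfNormal_real_Iic, ← halfNormal_real_Iic]
  exact measureReal_mono (Set.Iic_subset_Iic.2 hst)

-- Layer-cake formula; the event that the maximum is at most t is a box, whose product measure is a
-- power of the distribution function.
open Set in
lemma halfNormalMaxMean_eq_integral {n : ℕ} (hn : 1 ≤ n) :
    halfNormalMaxMean n = ∫ t in Ioi 0, (1 - halfNormalCDF t ^ n) := by
  have : Nonempty (Fin n) := ⟨⟨0, hn⟩⟩
  have hm : Measurable fun x : Fin n → ℝ => ⨆ i, x i :=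
    Measurable.iSup fun i => measurable_pi_apply i
  have hbdd : ∀ x : Fin n → ℝ, BddAbove (range x) := fun x => (finite_range x).bddAbove
  have hnn : ∀ᵐ x ∂(Measure.pi fun _ : Fin n => halfNormal), 0 ≤ ⨆ i, x i := by
    have h0 : ∀ᵐ y ∂halfNormal, 0 ≤ y := by
      rw [ae_iff]
      exact measure_mono_null (fun y hy => by simp at hy ⊢; exact hy.le) halfNormal_Iic_zero
    filter_upwards [(Measure.quasiMeasurePreserving_eval (μ := fun _ : Fin n => halfNormal)
      ⟨0, hn⟩).ae h0] with x hx
    exact le_trans hx (le_ciSup (hbdd x) _)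
  rw [halfNormalMaxMean, integral_eq_lintegral_of_nonneg_ae hnn hm.aestronglyMeasurable,
    lintegral_eq_lintegral_meas_lt _ hnn hm.aemeasurable, integral_eq_lintegral_of_nonneg_ae]
  · congr 1
    refine setLIntegral_congr_fun measurableSet_Ioi fun t _ => ?_
    have h1 : {x : Fin n → ℝ | t < ⨆ i, x i} = (univ.pi fun _ => Iic t)ᶜ := by
      ext x
      simp [ciSup_le_iff (hbdd x), ← not_le, Pi.le_def]
    show _ = ENNReal.ofReal (1 - halfNormalCDF t ^ n)
    rw [h1, ← ENNReal.ofReal_toReal (measure_ne_top _ _), ← measureReal_def,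
      probReal_compl_eq_one_sub (MeasurableSet.univ_pi fun _ => measurableSet_Iic),
      measureReal_def, Measure.pi_pi]
    simp [← halfNormal_real_Iic, measureReal_def]
  · exact Eventually.of_forall fun t => sub_nonneg.2
      (pow_le_one₀ (halfNormalCDF_nonneg t) (halfNormalCDF_le_one t))
  · exact ((monotone_halfNormalCDF.measurable.pow_const n).const_sub 1).aestronglyMeasurable

lemma halfNormalTail_le {t : ℝ} (ht : 0 < t) :
    halfNormalTail t ≤ Real.sqrt (2 / Real.pi) * (Real.exp (-t ^ 2 / 2) / t) :=
  mul_le_mul_of_nonneg_left (integral_exp_neg_sq_half_Ioi_le ht) (Real.sqrt_nonneg _)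

lemma le_halfNormalTail {t : ℝ} (ht : 0 ≤ t) :
    Real.sqrt (2 / Real.pi) * (Real.exp (-t ^ 2 / 2) / (1 + t)) ≤ halfNormalTail t :=
  mul_le_mul_of_nonneg_left (le_integral_exp_neg_sq_half_Ioi ht) (Real.sqrt_nonneg _)

/-- A bound without the singularity of 1/t at 0, which makes it an integrable majorant on the whole
half-line. -/
lemma halfNormalTail_le_exp {t : ℝ} (ht : 0 < t) :
    halfNormalTail t ≤ Real.exp 1 * Real.exp (-t ^ 2 / 2) := by
  rcases le_or_gt t 1 with h | h
  · refine (halfNormalTail_le_one ht.le).trans ?_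
    rw [← Real.exp_add]
    exact Real.one_le_exp (by nlinarith)
  · refine (halfNormalTail_le ht).trans ?_
    have h1 : Real.sqrt (2 / Real.pi) ≤ Real.exp 1 := by
      refine (Real.sqrt_le_one.2 ?_).trans (Real.one_le_exp zero_le_one)
      rw [div_le_one Real.pi_pos]
      exact Real.two_le_pi
    gcongr
    exact div_le_self (Real.exp_pos _).le h.le

lemma one_sub_halfNormalCDF_pow_le {t : ℝ} (ht : 0 < t) (n : ℕ) :
    1 - halfNormalCDF t ^ n ≤ n * halfNormalTail t := by
  rw [halfNormalCDF, if_pos ht]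
  have h := one_add_mul_le_pow (a := -halfNormalTail t)
    (by linarith [halfNormalTail_le_one ht.le]) n
  rw [← sub_eq_add_neg] at h
  linarith

open Set in
lemma integrableOn_one_sub_halfNormalCDF_pow (n : ℕ) :
    IntegrableOn (fun t => 1 - halfNormalCDF t ^ n) (Ioi 0) := by
  refine Integrable.mono' (g := fun t => n * (Real.exp 1 * Real.exp (-t ^ 2 / 2)))
    ((integrable_exp_neg_sq_half.const_mul _).const_mul _).integrableOn
    ((monotone_halfNormalCDF.measurable.pow_const n).const_sub 1).aestronglyMeasurable ?_
  filter_upwards [ae_restrict_mem measurableSet_Ioi] with t ht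
  rw [Real.norm_of_nonneg (sub_nonneg.2
    (pow_le_one₀ (halfNormalCDF_nonneg t) (halfNormalCDF_le_one t)))]
  exact (one_sub_halfNormalCDF_pow_le ht n).trans
    (mul_le_mul_of_nonneg_left (halfNormalTail_le_exp ht) n.cast_nonneg)

/-! ### Extreme-value normalization and the expansion of μ_n. -/

/-- The reciprocal of the scale of the maximum of `n` half-normal variables. -/
noncomputable def maxScale (n : ℕ) : ℝ := Real.sqrt (2 * Real.log n)

/-- The correction to the location of the maximum of `n` half-normal variables, in units of the
scale. -/
noncomputable def maxShift (n : ℕ) : ℝ := (Real.log (Real.log n) + Real.log Real.pi) / 2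

lemma tendsto_log_natCast : Tendsto (fun n : ℕ => Real.log n) atTop atTop :=
  Real.tendsto_log_atTop.comp tendsto_natCast_atTop_atTop

lemma tendsto_maxScale : Tendsto maxScale atTop atTop :=
  Real.tendsto_sqrt_atTop.comp (tendsto_log_natCast.const_mul_atTop two_pos)

lemma tendsto_maxShift : Tendsto maxShift atTop atTop :=
  (tendsto_atTop_add_const_right _ _
    (Real.tendsto_log_atTop.comp tendsto_log_natCast)).atTop_div_const two_pos

lemma tendsto_log_div_sqrt : Tendsto (fun x => Real.log x / Real.sqrt x) atTop (nhds 0) := by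
  have h := isLittleO_log_rpow_atTop (r := 1 / 2) (by norm_num)
  simpa [Real.sqrt_eq_rpow] using h.tendsto_div_nhds_zero

lemma tendsto_maxShift_div_maxScale :
    Tendsto (fun n => maxShift n / maxScale n) atTop (nhds 0) := by
  have h1 := (tendsto_log_div_sqrt.comp tendsto_log_natCast).const_mul ((2 * Real.sqrt 2)⁻¹)
  have h2 : Tendsto (fun n => (Real.log Real.pi / 2) / maxScale n) atTop (nhds 0) :=
    tendsto_const_nhds.div_atTop tendsto_maxScale
  have h := h1.add h2
  rw [mul_zero, add_zero] at h
  refine h.congr fun n => ?_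
  simp only [maxShift, maxScale, Function.comp]
  rw [Real.sqrt_mul (by norm_num)]
  field_simp

/-- The half-normal density at the normalized points. -/
lemma mul_exp_neg_normalized_sq {n : ℕ} (hn : 2 ≤ n) (x : ℝ) :
    n * (Real.sqrt (2 / Real.pi) *
      Real.exp (-((maxScale n - maxShift n / maxScale n) + x / maxScale n) ^ 2 / 2)) =
    maxScale n * Real.exp (-x) * Real.exp (-((x - maxShift n) / maxScale n) ^ 2 / 2) := by
  have hn0 : (0 : ℝ) < n := by positivity
  have hL : 0 < Real.log n := Real.log_pos (by exact_mod_cast hn)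
  have hb : 0 < maxScale n := Real.sqrt_pos.2 (by positivity)
  have hb2 : maxScale n ^ 2 = 2 * Real.log n := Real.sq_sqrt (by positivity)
  have e1 : -((maxScale n - maxShift n / maxScale n) + x / maxScale n) ^ 2 / 2 =
      -Real.log n + maxShift n + (-x) + (-((x - maxShift n) / maxScale n) ^ 2 / 2) := by
    have : Real.log n = maxScale n ^ 2 / 2 := by linarith
    rw [this]
    field_simp
    ring
  -- This explains the choice of `maxShift`: multiplied by √(2/π), its exponential is exactly
  -- `maxScale n`, which cancels the factor 1/t ~ 1/`maxScale n` in Mills' ratio.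
  have e2 : Real.exp (maxShift n) = Real.sqrt (Real.log n * Real.pi) := by
    rw [maxShift, Real.exp_half, ← Real.log_mul hL.ne' Real.pi_ne_zero,
      Real.exp_log (mul_pos hL Real.pi_pos)]
  have e3 : maxScale n = Real.sqrt (2 / Real.pi) * Real.sqrt (Real.log n * Real.pi) := by
    rw [maxScale, ← Real.sqrt_mul (by positivity)]
    congr 1
    field_simp
  rw [e1, Real.exp_add, Real.exp_add, Real.exp_add, Real.exp_neg (Real.log n), Real.exp_log hn0, e2]
  generalize Real.exp (-x) = u, Real.exp (-((x - maxShift n) / maxScale n) ^ 2 / 2) = v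
  rw [e3]
  field_simp

/-- Lower and upper bounds for the survival function at the normalized points. -/
lemma mul_halfNormalTail_bounds {n : ℕ} (hn : 2 ≤ n) {x t : ℝ}
    (ht : t = (maxScale n - maxShift n / maxScale n) + x / maxScale n) (ht0 : 0 < t) :
    maxScale n / (1 + t) * (Real.exp (-x) * Real.exp (-((x - maxShift n) / maxScale n) ^ 2 / 2)) ≤
      n * halfNormalTail t ∧
    n * halfNormalTail t ≤
      maxScale n / t * (Real.exp (-x) * Real.exp (-((x - maxShift n) / maxScale n) ^ 2 / 2)) := by
  have h := mul_exp_neg_normalized_sq hn x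
  rw [← ht] at h
  constructor
  · refine Eq.trans_le ?_ (mul_le_mul_of_nonneg_left (le_halfNormalTail ht0.le) n.cast_nonneg)
    rw [div_mul_eq_mul_div, ← mul_assoc (maxScale n), ← h]
    ring
  · refine (mul_le_mul_of_nonneg_left (halfNormalTail_le ht0) n.cast_nonneg).trans_eq ?_
    rw [div_mul_eq_mul_div, ← mul_assoc (maxScale n), ← h]
    ring

/-- The values c = 0 and c = 1 serve the denominators t and 1 + t of the upper and lower Mills
bounds. -/
lemma tendsto_normalized_div (x c : ℝ) :
    Tendsto (fun n => (c + ((maxScale n - maxShift n / maxScale n) + x / maxScale n)) / maxScale n)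
      atTop (nhds 1) := by
  have h1 : Tendsto (fun n => c / maxScale n) atTop (nhds 0) :=
    tendsto_const_nhds.div_atTop tendsto_maxScale
  have h2 : Tendsto (fun n => x / maxScale n) atTop (nhds 0) :=
    tendsto_const_nhds.div_atTop tendsto_maxScale
  have h3 := tendsto_maxShift_div_maxScale.div_atTop tendsto_maxScale
  have h4 := h2.div_atTop tendsto_maxScale
  have h := ((tendsto_const_nhds (x := (1 : ℝ))).sub h3).add (h1.add h4)
  rw [sub_zero, add_zero, add_zero] at h
  refine h.congr' ?_
  filter_upwards [tendsto_maxScale.eventually_gt_atTop 0] with n hn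
  field_simp
  ring

lemma tendsto_normalized (x : ℝ) :
    Tendsto (fun n => (maxScale n - maxShift n / maxScale n) + x / maxScale n) atTop atTop := by
  have h := (tendsto_normalized_div x 0).pos_mul_atTop one_pos tendsto_maxScale
  refine h.congr' ?_
  filter_upwards [tendsto_maxScale.eventually_gt_atTop 0] with n hn
  rw [div_mul_cancel₀ _ hn.ne', zero_add]

lemma tendsto_mul_halfNormalTail (x : ℝ) :
    Tendsto (fun n : ℕ => n *
      halfNormalTail ((maxScale n - maxShift n / maxScale n) + x / maxScale n)) atTop
      (nhds (Real.exp (-x))) := by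
  have hx : Tendsto (fun n => (x - maxShift n) / maxScale n) atTop (nhds 0) := by
    have h2 : Tendsto (fun n => x / maxScale n) atTop (nhds 0) :=
      tendsto_const_nhds.div_atTop tendsto_maxScale
    simpa [sub_div] using h2.sub tendsto_maxShift_div_maxScale
  have hE : Tendsto (fun n => Real.exp (-x) *
      Real.exp (-((x - maxShift n) / maxScale n) ^ 2 / 2)) atTop (nhds (Real.exp (-x))) := by
    simpa using ((Real.continuous_exp.tendsto _).comp
      (((hx.pow 2).neg).div_const 2)).const_mul (Real.exp (-x))
  have hl := ((tendsto_normalized_div x 1).inv₀ one_ne_zero).mul hE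
  have hu := ((tendsto_normalized_div x 0).inv₀ one_ne_zero).mul hE
  simp only [inv_one, one_mul, inv_div, zero_add] at hl hu
  refine tendsto_of_tendsto_of_tendsto_of_le_of_le' hl hu ?_ ?_
  · filter_upwards [eventually_ge_atTop 2, (tendsto_normalized x).eventually_gt_atTop 0] with n h1 h2
    exact (mul_halfNormalTail_bounds h1 rfl h2).1
  · filter_upwards [eventually_ge_atTop 2, (tendsto_normalized x).eventually_gt_atTop 0] with n h1 h2
    exact (mul_halfNormalTail_bounds h1 rfl h2).2

/-- The normalized maximum of half-normal variables converges in law to the Gumbel distribution. -/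
lemma tendsto_halfNormalCDF_pow (x : ℝ) :
    Tendsto (fun n =>
      halfNormalCDF ((maxScale n - maxShift n / maxScale n) + x / maxScale n) ^ n) atTop
      (nhds (Real.exp (-Real.exp (-x)))) := by
  have h := Real.tendsto_one_add_pow_exp_of_tendsto (t := -Real.exp (-x))
    (g := fun n => -halfNormalTail ((maxScale n - maxShift n / maxScale n) + x / maxScale n))
    (by simpa using (tendsto_mul_halfNormalTail x).neg)
  refine h.congr' ?_
  filter_upwards [(tendsto_normalized x).eventually_gt_atTop 0] with n hn
  rw [halfNormalCDF, if_pos hn, sub_eq_add_neg (1 : ℝ)]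

-- For x > 0, Bernoulli's inequality bounds the difference by n times the tail, hence by 2 e^{-x}.
-- For x ≤ 0 the power is at most exp(−n · tail), so a lower bound on n · tail that is linear in -x
-- suffices.
open Set in
lemma abs_step_sub_halfNormalCDF_pow_le {n : ℕ} (hn : 2 ≤ n) (hb : 1 ≤ maxScale n)
    (hd : 0 ≤ maxShift n) (hdb : maxShift n ≤ maxScale n / 2) (x : ℝ) :
    |(Ioi (0 : ℝ)).indicator 1 x -
      halfNormalCDF ((maxScale n - maxShift n / maxScale n) + x / maxScale n) ^ n| ≤
      2 * Real.exp (-(1 / 8 * |x|)) := by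
  set b := maxScale n with hbdef
  set d := maxShift n with hddef
  have hb0 : 0 < b := by linarith
  have hdb1 : d / b ≤ 1 / 2 := by rw [div_le_iff₀ hb0]; linarith
  have hdb0 : 0 ≤ d / b := by positivity
  set t := (b - d / b) + x / b with ht
  by_cases hx : 0 < x
  · have hxb : 0 < x / b := by positivity
    have ht0 : b / 2 ≤ t := by rw [ht]; linarith
    have htp : 0 < t := by linarith
    rw [indicator_of_mem (mem_Ioi.2 hx), Pi.one_apply, abs_of_nonneg (sub_nonneg.2
      (pow_le_one₀ (halfNormalCDF_nonneg t) (halfNormalCDF_le_one t))), abs_of_pos hx]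
    refine (one_sub_halfNormalCDF_pow_le htp n).trans
      ((mul_halfNormalTail_bounds hn ht htp).2.trans ?_)
    have h1 : b / t ≤ 2 := by rw [div_le_iff₀ htp]; linarith
    have h2 : Real.exp (-((x - d) / b) ^ 2 / 2) ≤ 1 :=
      Real.exp_le_one_iff.2 (by nlinarith [sq_nonneg ((x - d) / b)])
    have h3 : Real.exp (-x) ≤ Real.exp (-(1 / 8 * x)) := Real.exp_le_exp.2 (by linarith)
    calc b / t * (Real.exp (-x) * Real.exp (-((x - d) / b) ^ 2 / 2))
        ≤ 2 * (Real.exp (-(1 / 8 * x)) * 1) := by gcongr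
      _ = _ := by ring
  · have hx' := not_lt.1 hx
    rw [indicator_of_notMem (by simpa using hx), zero_sub, abs_neg,
      abs_of_nonneg (pow_nonneg (halfNormalCDF_nonneg t) n), abs_of_nonpos hx']
    rw [halfNormalCDF]
    split_ifs with htp
    · have hQ := (mul_halfNormalTail_bounds hn ht htp).1
      have hxb : x / b ≤ 0 := div_nonpos_of_nonpos_of_nonneg hx' hb0.le
      have h1 : 1 / 2 ≤ b / (1 + t) := by
        rw [le_div_iff₀ (by linarith), ht]
        linarith
      -- Positivity of t confines x to a range where the quadratic term (x − d)²/(2b²) uses up at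
      -- most 3/4 of -x, plus 1.
      have hxab : -x ≤ b ^ 2 - d := by
        have : 0 < t * b := by positivity
        rw [ht, show (b - d / b + x / b) * b = b ^ 2 - d + x by field_simp] at this
        linarith
      have h2 : -x / 4 - 1 ≤ -x + (-((x - d) / b) ^ 2 / 2) := by
        have e : (x - d) ^ 2 ≤ b ^ 2 * (2 * (-x + (x / 4 + 1))) := by
          nlinarith [mul_nonneg (neg_nonneg.2 hx') (sub_nonneg.2 hxab),
            mul_nonneg (neg_nonneg.2 hx') (show 0 ≤ b ^ 2 / 2 - d by nlinarith),
            show d ^ 2 ≤ b ^ 2 by nlinarith]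
        have : ((x - d) / b) ^ 2 ≤ 2 * (-x + (x / 4 + 1)) := by
          rw [div_pow, div_le_iff₀ (by positivity)]
          linarith
        linarith
      -- The exponent is at least -x/4 − 1, so its exponential is at least -x/4; the Mills factor
      -- 1/2 then gives the constant 1/8.
      have h3 : -x / 8 ≤ n * halfNormalTail t := by
        refine le_trans ?_ hQ
        rw [← Real.exp_add]
        have h4 := Real.add_one_le_exp (-x + (-((x - d) / b) ^ 2 / 2))
        calc -x / 8 = 1 / 2 * (-x / 4) := by ring
          _ ≤ 1 / 2 * Real.exp (-x + (-((x - d) / b) ^ 2 / 2)) := by linarith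
          _ ≤ _ := by gcongr
      calc (1 - halfNormalTail t) ^ n ≤ Real.exp (-halfNormalTail t) ^ n := by
            refine pow_le_pow_left₀ (by linarith [halfNormalTail_le_one htp.le]) ?_ n
            linarith [Real.add_one_le_exp (-halfNormalTail t)]
        _ = Real.exp (-(n * halfNormalTail t)) := by rw [← Real.exp_nat_mul]; congr 1; ring
        _ ≤ Real.exp (-(1 / 8 * -x)) := Real.exp_le_exp.2 (by linarith)
        _ ≤ _ := by linarith [Real.exp_pos (-(1 / 8 * -x))]
    · rw [zero_pow (by omega)]
      positivity

/-- The normalized expected maximum of half-normal variables converges to the mean of the Gumbel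
distribution. -/
lemma tendsto_maxScale_mul_halfNormalMaxMean_sub :
    Tendsto (fun n => maxScale n *
      (halfNormalMaxMean n - (maxScale n - maxShift n / maxScale n))) atTop
      (nhds Real.eulerMascheroniConstant) := by
  have hev : ∀ᶠ n in atTop, 2 ≤ n ∧ 1 ≤ maxScale n ∧ 0 ≤ maxShift n ∧
      maxShift n ≤ maxScale n / 2 := by
    filter_upwards [eventually_ge_atTop 2, tendsto_maxScale.eventually_ge_atTop 1,
      tendsto_maxShift.eventually_ge_atTop 0,
      tendsto_maxShift_div_maxScale.eventually_le_const (u := 1 / 2) (by norm_num)] with n h1 h2 h3 h4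
    rw [div_le_iff₀ (by linarith)] at h4
    exact ⟨h1, h2, h3, by linarith⟩
  have h := tendsto_integral_step_sub_gumbel (C := 2) (c := 1 / 8) (by norm_num)
    (P := fun n x => halfNormalCDF ((maxScale n - maxShift n / maxScale n) + x / maxScale n) ^ n)
    (fun n => (monotone_halfNormalCDF.measurable.comp (by fun_prop)).pow_const n)
    (by filter_upwards [hev] with n hn x
        exact abs_step_sub_halfNormalCDF_pow_le hn.1 hn.2.1 hn.2.2.1 hn.2.2.2 x)
    tendsto_halfNormalCDF_pow
  rw [integral_step_sub_gumbel] at h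
  refine h.congr' ?_
  filter_upwards [hev] with n ⟨h1, h2, h3, h4⟩
  have hb0 : 0 < maxScale n := by linarith
  rw [integral_step_sub_comp_affine (F := fun t => halfNormalCDF t ^ n) _
    (integrableOn_one_sub_halfNormalCDF_pow n) _ hb0, halfNormalMaxMean_eq_integral (by omega)]
  · intro t ht
    simp only [halfNormalCDF, if_neg (not_lt.2 ht)]
    exact zero_pow (by omega)
  · rw [sub_nonneg, div_le_iff₀ hb0]
    nlinarith

lemma halfNormalMaxMean_isLittleO :
    (fun n : ℕ => halfNormalMaxMean n -
        (Real.sqrt (2 * Real.log n) -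
          (Real.log (Real.log n) + Real.log Real.pi - 2 * Real.eulerMascheroniConstant) /
            (2 * Real.sqrt (2 * Real.log n))))
      =o[atTop] fun n : ℕ => 1 / Real.sqrt (Real.log n) := by
  have h := (tendsto_maxScale_mul_halfNormalMaxMean_sub.sub_const
    Real.eulerMascheroniConstant).const_mul ((Real.sqrt 2)⁻¹)
  rw [sub_self, mul_zero] at h
  refine isLittleO_of_tendsto' ?_ (h.congr' ?_)
  · filter_upwards [tendsto_log_natCast.eventually_gt_atTop 0] with n hn h0
    exact absurd h0 (by positivity)
  · filter_upwards [tendsto_log_natCast.eventually_gt_atTop 0] with n hn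
    have h1 : 0 < Real.sqrt (Real.log n) := Real.sqrt_pos.2 hn
    simp only [maxScale, maxShift]
    rw [Real.sqrt_mul (by norm_num)]
    field_simp
    rw [Real.sq_sqrt (by norm_num)]
    ring

/-! ### Gaussian radial moments and the mean norm. -/

/-- The moments of `exp (-r ^ 2 / 2)` on the positive half-line. -/
noncomputable def gaussianMoment (k : ℕ) : ℝ :=
  ∫ r in Set.Ioi (0 : ℝ), r ^ k * Real.exp (-r ^ 2 / 2)

lemma gaussianMoment_eq (k : ℕ) :
    gaussianMoment k = (1 / 2 : ℝ) ^ (-((k : ℝ) + 1) / 2) * (1 / 2) *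
      Real.Gamma (((k : ℝ) + 1) / 2) := by
  rw [← integral_rpow_mul_exp_neg_mul_rpow (p := 2) (q := k) (b := 1 / 2) two_pos
    (by linarith [(k.cast_nonneg : (0 : ℝ) ≤ k)]) (by norm_num), gaussianMoment]
  refine setIntegral_congr_fun measurableSet_Ioi fun r _ => ?_
  simp only [Real.rpow_natCast, Real.rpow_two]
  congr 2
  ring

lemma gaussianMoment_pos (k : ℕ) : 0 < gaussianMoment k := by
  rw [gaussianMoment_eq]
  have := Real.Gamma_pos_of_pos (s := ((k : ℝ) + 1) / 2) (by positivity)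
  positivity

lemma gaussianMoment_add_two (k : ℕ) : gaussianMoment (k + 2) = (k + 1) * gaussianMoment k := by
  rw [gaussianMoment_eq, gaussianMoment_eq]
  push_cast
  rw [show ((k : ℝ) + 2 + 1) / 2 = (k + 1) / 2 + 1 by ring, Real.Gamma_add_one (by positivity),
    show -((k : ℝ) + 2 + 1) / 2 = -(k + 1) / 2 - 1 by ring, Real.rpow_sub_one (by norm_num)]
  ring

/-- Log-convexity of Gamma at the midpoint of s and s + 1, where s = (k + 1)/2. -/
lemma gaussianMoment_succ_sq_le (k : ℕ) :
    gaussianMoment (k + 1) ^ 2 ≤ gaussianMoment k * gaussianMoment (k + 2) := by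
  set s : ℝ := ((k : ℝ) + 1) / 2 with hs
  have hs0 : 0 < s := by positivity
  have h := Real.Gamma_mul_add_mul_le_rpow_Gamma_mul_rpow_Gamma hs0
    (show 0 < s + 1 by linarith) (a := 1 / 2) (b := 1 / 2) (by norm_num) (by norm_num) (by norm_num)
  rw [show 1 / 2 * s + 1 / 2 * (s + 1) = s + 1 / 2 by ring, ← Real.sqrt_eq_rpow,
    ← Real.sqrt_eq_rpow] at h
  have hG := Real.Gamma_pos_of_pos (show 0 < s + 1 / 2 by linarith)
  have hG0 := Real.Gamma_pos_of_pos hs0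
  have hG1 := Real.Gamma_pos_of_pos (show 0 < s + 1 by linarith)
  have h2 : Real.Gamma (s + 1 / 2) ^ 2 ≤ Real.Gamma s * Real.Gamma (s + 1) := by
    refine (pow_le_pow_left₀ hG.le h 2).trans_eq ?_
    rw [mul_pow, Real.sq_sqrt hG0.le, Real.sq_sqrt hG1.le]
  rw [gaussianMoment_eq, gaussianMoment_eq, gaussianMoment_eq]
  push_cast
  rw [show ((k : ℝ) + 2 + 1) / 2 = s + 1 by rw [hs]; ring,
    show ((k : ℝ) + 1 + 1) / 2 = s + 1 / 2 by rw [hs]; ring,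
    show -((k : ℝ) + 2 + 1) / 2 = -s - 1 by rw [hs]; ring,
    show -((k : ℝ) + 1 + 1) / 2 = -s - 1 / 2 by rw [hs]; ring,
    show -((k : ℝ) + 1) / 2 = -s by rw [hs]; ring, Real.rpow_sub (by norm_num) (-s) (1 / 2),
    Real.rpow_sub_one (by norm_num), ← Real.sqrt_eq_rpow]
  have hq : Real.sqrt (1 / 2) ^ 2 = 1 / 2 := Real.sq_sqrt (by norm_num)
  calc _ = ((1 / 2 : ℝ) ^ (-s)) ^ 2 / Real.sqrt (1 / 2) ^ 2 * (1 / 4) * Real.Gamma (s + 1 / 2) ^ 2 := by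
        ring
    _ ≤ ((1 / 2 : ℝ) ^ (-s)) ^ 2 / Real.sqrt (1 / 2) ^ 2 * (1 / 4) *
        (Real.Gamma s * Real.Gamma (s + 1)) := by gcongr
    _ = _ := by rw [hq]; ring

/-- The mean of the Euclidean norm of a standard Gaussian vector in dimension `n`. -/
noncomputable def gaussianNormMean (n : ℕ) : ℝ := gaussianMoment n / gaussianMoment (n - 1)

lemma gaussianNormMean_pos (n : ℕ) : 0 < gaussianNormMean n :=
  div_pos (gaussianMoment_pos _) (gaussianMoment_pos _)

lemma gaussianNormMean_le {n : ℕ} (hn : 1 ≤ n) : gaussianNormMean n ≤ Real.sqrt n := by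
  obtain ⟨k, rfl⟩ := Nat.exists_eq_add_of_le' hn
  refine Real.le_sqrt_of_sq_le ?_
  have h := gaussianMoment_succ_sq_le k
  rw [gaussianMoment_add_two] at h
  have h0 := gaussianMoment_pos k
  rw [gaussianNormMean, add_tsub_cancel_right, div_pow, div_le_iff₀ (by positivity)]
  push_cast
  linarith

/-- Writing M_k for the moments and n = k + 2, log-convexity gives (M_{k+2}/M_{k+1})² ≥ M_{k+2}/M_k,
and the recurrence makes the right side k + 1. -/
lemma le_gaussianNormMean {n : ℕ} (hn : 2 ≤ n) : Real.sqrt (n - 1) ≤ gaussianNormMean n := by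
  obtain ⟨k, rfl⟩ := Nat.exists_eq_add_of_le' hn
  refine Real.sqrt_le_iff.2 ⟨(gaussianNormMean_pos _).le, ?_⟩
  have h := gaussianMoment_succ_sq_le k
  have h2 := gaussianMoment_add_two k
  have h0 := gaussianMoment_pos k
  have h1 := gaussianMoment_pos (k + 1)
  rw [gaussianNormMean, show k + 2 - 1 = k + 1 by omega, div_pow, le_div_iff₀ (by positivity)]
  push_cast
  calc ((k : ℝ) + 2 - 1) * gaussianMoment (k + 1) ^ 2
      ≤ ((k : ℝ) + 2 - 1) * (gaussianMoment k * gaussianMoment (k + 2)) := by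
        refine mul_le_mul_of_nonneg_left h ?_
        linarith [(k.cast_nonneg : (0 : ℝ) ≤ k)]
    _ = _ := by rw [h2]; ring

/-! ### Polar coordinates and spherical averages. -/

open Set in
/-- Integration in polar coordinates of the product of a positively homogeneous function and a
radial function. -/
lemma integral_homogeneous_mul_radial {E : Type*} [NormedAddCommGroup E] [NormedSpace ℝ E]
    [MeasurableSpace E] [BorelSpace E] [FiniteDimensional ℝ E] [Nontrivial E] (μ : Measure E)
    [μ.IsAddHaarMeasure] (f : E → ℝ) (k : ℕ)
    (hf : ∀ (r : ℝ) (x : E), 0 < r → f (r • x) = r ^ k * f x) (g : ℝ → ℝ) :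
    ∫ x, f x * g ‖x‖ ∂μ = (∫ u : Metric.sphere (0 : E) 1, f u ∂μ.toSphere) *
      ∫ r in Ioi (0 : ℝ), r ^ (Module.finrank ℝ E - 1) * (r ^ k * g r) := by
  calc ∫ x, f x * g ‖x‖ ∂μ
      = ∫ x : ({(0)}ᶜ : Set E), f x.1 * g ‖x.1‖ ∂(μ.comap (↑)) := by
        rw [integral_subtype_comap (measurableSet_singleton _).compl fun x ↦ f x * g ‖x‖,
          restrict_compl_singleton]
    _ = ∫ x, f x.1 * ((x.2 : ℝ) ^ k * g x.2)
          ∂μ.toSphere.prod (.volumeIoiPow (Module.finrank ℝ E - 1)) := by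
        rw [← μ.measurePreserving_homeomorphUnitSphereProd.integral_comp
          (Homeomorph.measurableEmbedding _)]
        refine integral_congr_ae (Eventually.of_forall fun x => ?_)
        have hx : 0 < ‖x.1‖ := norm_pos_iff.2 x.2
        have := hf ‖x.1‖ (‖x.1‖⁻¹ • x.1) hx
        rw [smul_inv_smul₀ hx.ne'] at this
        simp only [homeomorphUnitSphereProd_apply_snd_coe, homeomorphUnitSphereProd_apply_fst_coe]
        rw [this]
        ring
    _ = _ := by
        rw [integral_prod_mul (fun u : Metric.sphere (0 : E) 1 => f u)
          (fun r : Ioi (0 : ℝ) => (r : ℝ) ^ k * g r)]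
        congr 1
        simp only [Measure.volumeIoiPow, ENNReal.ofReal]
        rw [integral_withDensity_eq_integral_smul,
          integral_subtype_comap measurableSet_Ioi
            fun a : ℝ ↦ Real.toNNReal (a ^ (Module.finrank ℝ E - 1)) • (a ^ k * g a),
          setIntegral_congr_fun measurableSet_Ioi fun x hx ↦ ?_]
        · rw [NNReal.smul_def, Real.coe_toNNReal _ (pow_nonneg hx.out.le _), smul_eq_mul]
        · exact (measurable_subtype_coe.pow_const _).real_toNNReal

/-- The average over the unit sphere of a function that is homogeneous of degree one, in terms of
its Gaussian mean. -/
lemma average_sphere_eq_gaussian {n : ℕ} (hn : 1 ≤ n) (f : EuclideanSpace ℝ (Fin n) → ℝ)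
    (hf : ∀ (r : ℝ) (x : EuclideanSpace ℝ (Fin n)), 0 < r → f (r • x) = r * f x) (c : ℝ)
    (hc : ∫ x : EuclideanSpace ℝ (Fin n), c * Real.exp (-‖x‖ ^ 2 / 2) = 1) :
    ⨍ u : Metric.sphere (0 : EuclideanSpace ℝ (Fin n)) 1, f u
        ∂(volume : Measure (EuclideanSpace ℝ (Fin n))).toSphere =
      (∫ x : EuclideanSpace ℝ (Fin n), f x * (c * Real.exp (-‖x‖ ^ 2 / 2))) /
        gaussianNormMean n := by
  have : Nonempty (Fin n) := ⟨⟨0, hn⟩⟩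
  set μ := (volume : Measure (EuclideanSpace ℝ (Fin n)))
  have h1 := integral_homogeneous_mul_radial μ f 1 (by simpa using hf)
    (fun r => c * Real.exp (-r ^ 2 / 2))
  -- The constant function supplies the normalization: dividing the two polar formulas eliminates
  -- both c and the area of the sphere.
  have h0 := integral_homogeneous_mul_radial μ (fun _ => 1) 0 (by simp)
    (fun r => c * Real.exp (-r ^ 2 / 2))
  have e1 : ∫ r in Set.Ioi (0 : ℝ), r ^ (n - 1) * (r ^ 1 * (c * Real.exp (-r ^ 2 / 2))) =
      c * gaussianMoment n := by
    rw [gaussianMoment, ← integral_const_mul]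
    congr 1
    ext r
    obtain ⟨k, rfl⟩ := Nat.exists_eq_add_of_le' hn
    simp only [add_tsub_cancel_right]
    ring
  have e0 : ∫ r in Set.Ioi (0 : ℝ), r ^ (n - 1) * (r ^ 0 * (c * Real.exp (-r ^ 2 / 2))) =
      c * gaussianMoment (n - 1) := by
    rw [gaussianMoment, ← integral_const_mul]
    congr 1
    ext r
    ring
  rw [finrank_euclideanSpace_fin, e1] at h1
  rw [finrank_euclideanSpace_fin, e0] at h0
  simp only [one_mul] at h0
  rw [hc, integral_const, smul_eq_mul, mul_one] at h0
  rw [average_eq, h1, gaussianNormMean, smul_eq_mul]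
  have hp := gaussianMoment_pos n
  have hp' := gaussianMoment_pos (n - 1)
  have hS : μ.toSphere.real Set.univ ≠ 0 := fun h => by simp [h] at h0
  have hc0 : c ≠ 0 := fun h => by simp [h] at h0
  field_simp
  linear_combination ((∫ u : Metric.sphere (0 : EuclideanSpace ℝ (Fin n)) 1, f u ∂μ.toSphere)) * h0

/-! ### The half-normal maximum as a Gaussian integral. -/

open ProbabilityTheory

lemma gaussianPDFReal_zero_one (x : ℝ) :
    gaussianPDFReal 0 1 x = (Real.sqrt (2 * Real.pi))⁻¹ * Real.exp (-x ^ 2 / 2) := by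
  simp [gaussianPDFReal]

open Set in
lemma gaussianReal_Ioi (t : ℝ) :
    gaussianReal 0 1 (Ioi t) = ENNReal.ofReal (halfNormalTail t / 2) := by
  rw [gaussianReal_apply_eq_integral 0 one_ne_zero]
  simp_rw [gaussianPDFReal_zero_one]
  rw [integral_const_mul, halfNormalTail, mul_div_right_comm]
  congr 2
  rw [Real.sqrt_mul (by norm_num), Real.sqrt_div (by norm_num)]
  have h2 : Real.sqrt 2 ^ 2 = 2 := Real.sq_sqrt (by norm_num)
  have h : 0 < Real.sqrt Real.pi := Real.sqrt_pos.2 Real.pi_pos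
  field_simp
  exact h2.symm

open Set in
/-- The half-normal law is the law of the absolute value of a standard normal variable. -/
lemma map_abs_gaussianReal : (gaussianReal 0 1).map (fun x => |x|) = halfNormal := by
  have hm : Measurable fun x : ℝ => |x| := measurable_norm
  have := Measure.isProbabilityMeasure_map (μ := gaussianReal 0 1) hm.aemeasurable
  refine Measure.ext_of_Iic _ _ fun t => ?_
  rcases lt_or_ge t 0 with ht | ht
  · rw [measure_mono_null (Iic_subset_Iic.2 ht.le) halfNormal_Iic_zero,
      Measure.map_apply hm measurableSet_Iic]
    convert measure_empty (μ := gaussianReal 0 1)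
    ext x
    simpa using ht.trans_le (abs_nonneg x)
  · rw [← compl_Ioi, prob_compl_eq_one_sub measurableSet_Ioi,
      prob_compl_eq_one_sub measurableSet_Ioi, halfNormal_Ioi ht,
      Measure.map_apply hm measurableSet_Ioi]
    have e : (fun x : ℝ => |x|) ⁻¹' Ioi t = Ioi t ∪ (fun x => -x) ⁻¹' Ioi t := by
      ext x
      simp [lt_abs, lt_neg]
    have hd : Disjoint (Ioi t) ((fun x : ℝ => -x) ⁻¹' Ioi t) := by
      rw [Set.disjoint_left]
      intro x hx hx'
      simp only [mem_Ioi, mem_preimage] at hx hx'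
      linarith
    rw [e, measure_union hd (measurable_neg measurableSet_Ioi),
      ← Measure.map_apply measurable_neg measurableSet_Ioi, gaussianReal_map_neg, neg_zero,
      gaussianReal_Ioi, ← ENNReal.ofReal_add, add_halves]
    all_goals exact div_nonneg (halfNormalTail_nonneg t) two_pos.le

open Set in
/-- The density of the product of standard normal laws. -/
lemma pi_gaussianReal_eq_withDensity {ι : Type*} [Fintype ι] :
    (Measure.pi fun _ : ι => gaussianReal 0 1) =
      volume.withDensity fun x => ENNReal.ofReal (∏ i, gaussianPDFReal 0 1 (x i)) := by
  refine Measure.pi_eq fun s hs => ?_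
  rw [withDensity_apply _ (MeasurableSet.univ_pi hs), ← ofReal_integral_eq_lintegral_ofReal]
  · rw [← integral_indicator (MeasurableSet.univ_pi hs)]
    have e : (univ.pi s).indicator (fun x : ι → ℝ => ∏ i, gaussianPDFReal 0 1 (x i)) =
        fun x => ∏ i, (s i).indicator (gaussianPDFReal 0 1) (x i) := by
      classical
      ext x
      by_cases h : x ∈ univ.pi s
      · rw [indicator_of_mem h]
        exact Finset.prod_congr rfl fun i _ => (indicator_of_mem (h i (mem_univ i)) _).symm
      · rw [indicator_of_notMem h]
        simp only [mem_univ_pi, not_forall] at h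
        obtain ⟨i, hi⟩ := h
        exact (Finset.prod_eq_zero (Finset.mem_univ i) (indicator_of_notMem hi _)).symm
    rw [e, integral_fintype_prod_volume_eq_prod, ENNReal.ofReal_prod_of_nonneg]
    · refine Finset.prod_congr rfl fun i _ => ?_
      rw [gaussianReal_apply_eq_integral 0 one_ne_zero, integral_indicator (hs i)]
    · exact fun i _ => integral_nonneg fun x =>
        indicator_nonneg (fun y _ => gaussianPDFReal_nonneg 0 1 y) x
  · exact (Integrable.fintype_prod (fun _ => integrable_gaussianPDFReal 0 1)).integrableOn
  · exact Eventually.of_forall fun x => Finset.prod_nonneg fun i _ => gaussianPDFReal_nonneg 0 1 _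

lemma prod_gaussianPDFReal {n : ℕ} (x : EuclideanSpace ℝ (Fin n)) :
    ∏ i, gaussianPDFReal 0 1 (x i) =
      (Real.sqrt (2 * Real.pi))⁻¹ ^ n * Real.exp (-‖x‖ ^ 2 / 2) := by
  simp_rw [gaussianPDFReal_zero_one]
  rw [Finset.prod_mul_distrib, ← Real.exp_sum, EuclideanSpace.norm_sq_eq]
  simp [← Finset.sum_div]

lemma integral_pi_gaussianReal {n : ℕ} (f : EuclideanSpace ℝ (Fin n) → ℝ) :
    ∫ x, f (WithLp.toLp 2 x) ∂(Measure.pi fun _ : Fin n => gaussianReal 0 1) =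
      ∫ x, f x * ((Real.sqrt (2 * Real.pi))⁻¹ ^ n * Real.exp (-‖x‖ ^ 2 / 2)) := by
  have hnn : ∀ x : Fin n → ℝ, 0 ≤ ∏ i, gaussianPDFReal 0 1 (x i) := fun x =>
    Finset.prod_nonneg fun i _ => gaussianPDFReal_nonneg 0 1 _
  rw [pi_gaussianReal_eq_withDensity, integral_withDensity_eq_integral_toReal_smul
    (by fun_prop) (by simp)]
  rw [← (EuclideanSpace.volume_preserving_symm_measurableEquiv_toLp (Fin n)).symm.integral_comp
    (MeasurableEquiv.measurableEmbedding _)]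
  refine integral_congr_ae (Eventually.of_forall fun x => ?_)
  simp only [ENNReal.toReal_ofReal (hnn _), smul_eq_mul]
  rw [← prod_gaussianPDFReal, mul_comm]
  rfl

/-- Taking coordinatewise absolute values pushes the standard Gaussian product to the half-normal
product; the radial density then admits polar coordinates. -/
lemma halfNormalMaxMean_eq_gaussian (n : ℕ) :
    halfNormalMaxMean n = ∫ x : EuclideanSpace ℝ (Fin n),
      (⨆ i, |x i|) * ((Real.sqrt (2 * Real.pi))⁻¹ ^ n * Real.exp (-‖x‖ ^ 2 / 2)) := by
  have hm : Measurable fun x : ℝ => |x| := measurable_norm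
  have : SigmaFinite ((gaussianReal 0 1).map fun x => |x|) := by
    rw [map_abs_gaussianReal]; infer_instance
  rw [← integral_pi_gaussianReal fun x => ⨆ i, |x i|, halfNormalMaxMean, ← map_abs_gaussianReal,
    ← Measure.pi_map_pi fun _ => hm.aemeasurable, integral_map]
  · exact (measurable_pi_iff.2 fun i => hm.comp (measurable_pi_apply i)).aemeasurable
  · exact (Measurable.iSup fun i => measurable_pi_apply i).aestronglyMeasurable

lemma integral_gaussian_density (n : ℕ) :
    ∫ x : EuclideanSpace ℝ (Fin n),
      (Real.sqrt (2 * Real.pi))⁻¹ ^ n * Real.exp (-‖x‖ ^ 2 / 2) = 1 := by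
  simpa using (integral_pi_gaussianReal (n := n) fun _ => 1).symm

/-- The average over the sphere of the largest absolute value of a coordinate. -/
lemma average_sphere_iSup_abs {n : ℕ} (hn : 1 ≤ n) :
    ⨍ u : Metric.sphere (0 : EuclideanSpace ℝ (Fin n)) 1, (⨆ i, |u.1 i|)
        ∂(volume : Measure (EuclideanSpace ℝ (Fin n))).toSphere =
      halfNormalMaxMean n / gaussianNormMean n := by
  rw [halfNormalMaxMean_eq_gaussian]
  refine average_sphere_eq_gaussian hn (fun x => ⨆ i, |x i|) (fun r x hr => ?_) _
    (integral_gaussian_density n)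
  simp only [PiLp.smul_apply, smul_eq_mul, abs_mul, abs_of_pos hr]
  exact (Real.mul_iSup_of_nonneg hr.le _).symm

/-! ### Geometry of the cross-polytope. -/

/-- The value of the support function of the cross-polytope is attained at a vertex. -/
lemma isGreatest_inner_crossPolytope {n : ℕ} (hn : 1 ≤ n) {l : ℝ} (hl : 0 ≤ l)
    (u : EuclideanSpace ℝ (Fin n)) :
    IsGreatest ((fun x => inner ℝ u x) '' crossPolytope n l) (l / Real.sqrt 2 * ⨆ i, |u i|) := by
  have : Nonempty (Fin n) := ⟨⟨0, hn⟩⟩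
  have hc : 0 ≤ l / Real.sqrt 2 := by positivity
  constructor
  · obtain ⟨i, hi⟩ := exists_eq_ciSup_of_finite (f := fun i => |u i|)
    rw [← hi]
    rcases le_total 0 (u i) with h | h
    · refine ⟨_, subset_convexHull ℝ _ ⟨i, Or.inl rfl⟩, ?_⟩
      simp [inner_smul_right, EuclideanSpace.inner_single_right, abs_of_nonneg h]
    · refine ⟨_, subset_convexHull ℝ _ ⟨i, Or.inr rfl⟩, ?_⟩
      simp [inner_smul_right, EuclideanSpace.inner_single_right, abs_of_nonpos h]
  · rintro _ ⟨x, hx, rfl⟩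
    have hle : ∀ i, |u i| ≤ ⨆ i, |u i| := le_ciSup (Set.finite_range _).bddAbove
    have hsub : crossPolytope n l ⊆ {x | inner ℝ u x ≤ l / Real.sqrt 2 * ⨆ i, |u i|} := by
      refine convexHull_min ?_ (convex_halfSpace_le
        ⟨fun x y => inner_add_right u x y, fun c x => inner_smul_right u x c⟩ _)
      rintro _ ⟨i, rfl | rfl⟩
      · simp only [Set.mem_ofPred_eq, inner_smul_right, EuclideanSpace.inner_single_right]
        simpa using mul_le_mul_of_nonneg_left ((le_abs_self _).trans (hle i)) hc
      · simp only [Set.mem_ofPred_eq, inner_neg_right, inner_smul_right,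
          EuclideanSpace.inner_single_right, ← mul_neg]
        simpa using mul_le_mul_of_nonneg_left ((neg_le_abs _).trans (hle i)) hc
    exact hsub hx

lemma width_crossPolytope {n : ℕ} (hn : 1 ≤ n) {l : ℝ} (hl : 0 ≤ l)
    (u : EuclideanSpace ℝ (Fin n)) :
    width (crossPolytope n l) u = Real.sqrt 2 * l * ⨆ i, |u i| := by
  have h2 : IsLeast ((fun x => inner ℝ u x) '' crossPolytope n l)
      (-(l / Real.sqrt 2 * ⨆ i, |u i|)) := by
    have h := isGreatest_inner_crossPolytope hn hl (-u)
    simp only [PiLp.neg_apply, abs_neg, inner_neg_left] at h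
    obtain ⟨⟨x, hx, hxe⟩, hu⟩ := h
    refine ⟨⟨x, hx, by simp only at hxe ⊢; linarith⟩, ?_⟩
    rintro _ ⟨y, hy, rfl⟩
    have := hu ⟨y, hy, rfl⟩
    simp only at this ⊢
    linarith
  rw [width, (isGreatest_inner_crossPolytope hn hl u).csSup_eq, h2.csInf_eq]
  have hq : Real.sqrt 2 ^ 2 = 2 := Real.sq_sqrt (by norm_num)
  have h0 : 0 < Real.sqrt 2 := by positivity
  field_simp
  rw [hq]
  ring

/-- The cross-polytope is a ball for the `ℓ¹` norm. -/
lemma mem_crossPolytope_iff {n : ℕ} (hn : 1 ≤ n) {l : ℝ} (hl : 0 < l)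
    (x : EuclideanSpace ℝ (Fin n)) :
    x ∈ crossPolytope n l ↔ ∑ i, |x i| ≤ l / Real.sqrt 2 := by
  have hc : 0 < l / Real.sqrt 2 := by positivity
  constructor
  · intro hx
    have hconv : Convex ℝ {x : EuclideanSpace ℝ (Fin n) | ∑ i, |x i| ≤ l / Real.sqrt 2} := by
      intro x hx y hy a b ha hb hab
      simp only [Set.mem_ofPred_eq] at hx hy ⊢
      calc ∑ i, |(a • x + b • y) i| ≤ ∑ i, (a * |x i| + b * |y i|) := by
            refine Finset.sum_le_sum fun i _ => ?_
            simp only [PiLp.add_apply, PiLp.smul_apply, smul_eq_mul]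
            refine (abs_add_le _ _).trans_eq ?_
            rw [abs_mul, abs_mul, abs_of_nonneg ha, abs_of_nonneg hb]
        _ = a * ∑ i, |x i| + b * ∑ i, |y i| := by
            rw [Finset.sum_add_distrib, Finset.mul_sum, Finset.mul_sum]
        _ ≤ a * (l / Real.sqrt 2) + b * (l / Real.sqrt 2) := by gcongr
        _ = _ := by rw [← add_mul, hab, one_mul]
    refine convexHull_min ?_ hconv hx
    have hs : ∀ i : Fin n, ∑ j, |((l / Real.sqrt 2) • EuclideanSpace.single i (1 : ℝ)) j| =
        l / Real.sqrt 2 := by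
      intro i
      rw [Finset.sum_eq_single i]
      · simpa using hc.le
      · intro j _ hj
        simp [hj]
      · simp
    rintro _ ⟨i, rfl | rfl⟩
    · exact (hs i).le
    · simp only [Set.mem_ofPred_eq, PiLp.neg_apply, abs_neg]
      exact (hs i).le
  · intro hx
    set c := l / Real.sqrt 2 with hcdef
    have hC : Convex ℝ (crossPolytope n l) := convex_convexHull ℝ _
    have hp : ∀ i : Fin n, c • EuclideanSpace.single i (1 : ℝ) ∈ crossPolytope n l := fun i =>
      subset_convexHull ℝ _ ⟨i, Or.inl rfl⟩
    have hm : ∀ i : Fin n, -(c • EuclideanSpace.single i (1 : ℝ)) ∈ crossPolytope n l := fun i =>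
      subset_convexHull ℝ _ ⟨i, Or.inr rfl⟩
    have h0 : (0 : EuclideanSpace ℝ (Fin n)) ∈ crossPolytope n l := by
      have := hC (hp ⟨0, hn⟩) (hm ⟨0, hn⟩) (a := 1 / 2) (b := 1 / 2) (by norm_num) (by norm_num)
        (by norm_num)
      simpa using this
    -- Each coordinate puts weight |x i|/c on the vertex of matching sign; the index `none` places
    -- the leftover weight at the origin.
    have key := hC.sum_mem (t := Finset.univ)
      (w := fun o : Option (Fin n) => o.elim (1 - ∑ i, |x i| / c) fun i => |x i| / c)
      (z := fun o : Option (Fin n) => o.elim 0 fun i => (SignType.sign (x i) : ℝ) •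
        (c • EuclideanSpace.single i (1 : ℝ))) ?_ ?_ ?_
    · convert key
      rw [Fintype.sum_option]
      ext j
      simp only [Option.elim, smul_zero, zero_add, WithLp.ofLp_sum, Finset.sum_apply,
        PiLp.smul_apply, smul_eq_mul]
      rw [Finset.sum_eq_single j]
      · have := abs_mul_sign (x j)
        simp only [PiLp.single_apply, if_true]
        rw [mul_one, ← mul_assoc, mul_right_comm, div_mul_cancel₀ _ hc.ne', this]
      · intro i _ hi
        simp [Ne.symm hi]
      · simp
    · rintro (_ | i) -
      · simp only [Option.elim, sub_nonneg, ← Finset.sum_div]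
        rwa [div_le_one hc]
      · simp only [Option.elim]
        positivity
    · simp [Fintype.sum_option]
    · rintro (_ | i) -
      · exact h0
      · simp only [Option.elim]
        rcases lt_trichotomy (x i) 0 with h | h | h
        · simpa [sign_neg h] using hm i
        · simpa [h] using h0
        · simpa [sign_pos h] using hp i

/-- Cauchy–Schwarz (‖x‖₁ ≤ √n ‖x‖₂) shows that the centred ball fits. No other centre does better,
by the ℓ¹ triangle inequality at two antipodal points of the ball. -/
lemma inradius_crossPolytope {n : ℕ} (hn : 1 ≤ n) {l : ℝ} (hl : 0 < l) :
    inradius (crossPolytope n l) = l / Real.sqrt (2 * n) := by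
  have hn0 : (0 : ℝ) < n := by exact_mod_cast hn
  have hsn : 0 < Real.sqrt n := Real.sqrt_pos.2 hn0
  have hc : 0 < l / Real.sqrt 2 := by positivity
  have hr : l / Real.sqrt (2 * n) = l / Real.sqrt 2 / Real.sqrt n := by
    rw [Real.sqrt_mul (by norm_num), div_div]
  refine IsGreatest.csSup_eq ⟨⟨by positivity, 0, fun x hx => ?_⟩, ?_⟩
  · rw [mem_crossPolytope_iff hn hl]
    rw [mem_closedBall_zero_iff, hr, le_div_iff₀ hsn] at hx
    refine le_trans ?_ hx
    rw [EuclideanSpace.norm_eq, ← Real.sqrt_mul (by positivity)]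
    refine Real.le_sqrt_of_sq_le ?_
    have := sq_sum_le_card_mul_sum_sq (s := Finset.univ) (f := fun i : Fin n => |x i|)
    simpa [mul_comm] using this
  · rintro r ⟨hr0, c, hsub⟩
    -- The facet normal (1, …, 1) scaled to length r, the equality case of Cauchy–Schwarz.
    set v : EuclideanSpace ℝ (Fin n) := WithLp.toLp 2 fun _ => r / Real.sqrt n with hv
    have hvn : ‖v‖ = r := by
      rw [EuclideanSpace.norm_eq]
      simp only [hv, Real.norm_eq_abs, sq_abs, div_pow, Finset.sum_const, Finset.card_univ,
        Fintype.card_fin, nsmul_eq_mul, Real.sq_sqrt hn0.le]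
      rw [mul_div_cancel₀ _ hn0.ne', Real.sqrt_sq hr0]
    have h1 := (mem_crossPolytope_iff hn hl _).1
      (hsub (show c + v ∈ Metric.closedBall c r by simp [hvn]))
    have h2 := (mem_crossPolytope_iff hn hl _).1
      (hsub (show c - v ∈ Metric.closedBall c r by simp [hvn]))
    have h3 : ∑ _i : Fin n, 2 * (r / Real.sqrt n) ≤ ∑ i, (|(c + v) i| + |(c - v) i|) := by
      refine Finset.sum_le_sum fun i _ => ?_
      have := abs_sub ((c + v) i) ((c - v) i)
      refine le_trans (le_trans (le_of_eq ?_) (le_abs_self _)) this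
      simp only [PiLp.add_apply, PiLp.sub_apply, hv]
      ring
    rw [Finset.sum_add_distrib, Finset.sum_const, Finset.card_univ, Fintype.card_fin,
      nsmul_eq_mul] at h3
    rw [hr, le_div_iff₀ hsn]
    have h4 : (n : ℝ) * (2 * (r / Real.sqrt n)) = 2 * (r * Real.sqrt n) := by
      field_simp
      rw [Real.sq_sqrt hn0.le, mul_comm]
    linarith

lemma smul_crossPolytope (n : ℕ) (a l : ℝ) :
    a • crossPolytope n l = crossPolytope n (a * l) := by
  rw [crossPolytope, ← convexHull_smul, crossPolytope]
  congr 1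
  ext v
  simp only [Set.mem_smul_set, Set.mem_ofPred_eq]
  constructor
  · rintro ⟨_, ⟨i, rfl | rfl⟩, rfl⟩
    · exact ⟨i, Or.inl (by rw [smul_smul, mul_div_assoc])⟩
    · exact ⟨i, Or.inr (by rw [smul_neg, smul_smul, mul_div_assoc])⟩
  · rintro ⟨i, rfl | rfl⟩
    · exact ⟨_, ⟨i, Or.inl rfl⟩, by rw [smul_smul, mul_div_assoc]⟩
    · exact ⟨_, ⟨i, Or.inr rfl⟩, by rw [smul_neg, smul_smul, mul_div_assoc]⟩

/-! ### Asymptotics of the mean widths. -/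

lemma meanWidth_crossPolytope {n : ℕ} (hn : 1 ≤ n) {l : ℝ} (hl : 0 ≤ l) :
    meanWidth (crossPolytope n l) =
      Real.sqrt 2 * l * (halfNormalMaxMean n / gaussianNormMean n) := by
  rw [meanWidth, ← average_sphere_iSup_abs hn, average_eq, average_eq]
  simp_rw [width_crossPolytope hn hl]
  rw [integral_const_mul, smul_eq_mul, smul_eq_mul]
  ring

lemma meanWidth_inradius_normalized_crossPolytope {n : ℕ} (hn : 1 ≤ n) :
    meanWidth ((inradius (crossPolytope n 1))⁻¹ • crossPolytope n 1) =
      2 * halfNormalMaxMean n * (Real.sqrt n / gaussianNormMean n) := by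
  rw [inradius_crossPolytope hn one_pos, smul_crossPolytope, meanWidth_crossPolytope hn
    (by positivity), Real.sqrt_mul (by norm_num)]
  have h := Real.sq_sqrt (show (0 : ℝ) ≤ 2 by norm_num)
  field_simp
  rw [h, mul_comm 2]

/-- The mean norm of a standard Gaussian vector in dimension `n` is close to `√n`. -/
lemma sqrt_div_gaussianNormMean_bounds {n : ℕ} (hn : 2 ≤ n) :
    0 ≤ Real.sqrt n / gaussianNormMean n - 1 ∧
      Real.sqrt n / gaussianNormMean n - 1 ≤ 1 / ((n : ℝ) - 1) := by
  have h0 := gaussianNormMean_pos n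
  have hn2 : (2 : ℝ) ≤ n := by exact_mod_cast hn
  have h1 := gaussianNormMean_le (show 1 ≤ n by omega)
  have h2 := le_gaussianNormMean hn
  have hs : 0 < Real.sqrt ((n : ℝ) - 1) := Real.sqrt_pos.2 (by linarith)
  constructor
  · rw [sub_nonneg, le_div_iff₀ h0, one_mul]
    exact h1
  · have h3 : Real.sqrt n / gaussianNormMean n ≤ Real.sqrt n / Real.sqrt ((n : ℝ) - 1) := by
      gcongr
    have h4 : Real.sqrt n / Real.sqrt ((n : ℝ) - 1) ≤ n / ((n : ℝ) - 1) := by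
      rw [← Real.sqrt_div (by linarith), Real.sqrt_le_left (div_nonneg (by linarith) (by linarith))]
      have : 1 ≤ (n : ℝ) / (n - 1) := by rw [le_div_iff₀ (by linarith)]; linarith
      exact le_self_pow₀ this two_ne_zero
    have h5 : (n : ℝ) / (n - 1) = 1 + 1 / (n - 1) := by
      have : (n : ℝ) - 1 ≠ 0 := by linarith
      field_simp
      ring
    linarith

/-- The factor log n is the order of μ_n √(log n), by which the relative error is multiplied in the
mean-width expansion. -/
lemma tendsto_log_mul_sqrt_div_gaussianNormMean_sub_one :
    Tendsto (fun n : ℕ => Real.log n * (Real.sqrt n / gaussianNormMean n - 1)) atTop (nhds 0) := by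
  have h : Tendsto (fun n : ℕ => 2 * (Real.log n / n)) atTop (nhds 0) := by
    have := (Real.isLittleO_log_id_atTop.tendsto_div_nhds_zero.comp
      tendsto_natCast_atTop_atTop).const_mul 2
    rw [mul_zero] at this
    exact this
  refine squeeze_zero' ?_ ?_ h
  · filter_upwards [eventually_ge_atTop 2] with n hn
    exact mul_nonneg (Real.log_natCast_nonneg n) (sqrt_div_gaussianNormMean_bounds hn).1
  · filter_upwards [eventually_ge_atTop 2] with n hn
    have hn2 : (2 : ℝ) ≤ n := by exact_mod_cast hn
    have h1 : 1 / ((n : ℝ) - 1) ≤ 2 / n := by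
      rw [div_le_div_iff₀ (by linarith) (by linarith)]
      linarith
    calc _ ≤ Real.log n * (2 / n) := mul_le_mul_of_nonneg_left
          ((sqrt_div_gaussianNormMean_bounds hn).2.trans h1) (Real.log_natCast_nonneg n)
      _ = _ := by ring

lemma tendsto_sqrt_div_gaussianNormMean :
    Tendsto (fun n : ℕ => Real.sqrt n / gaussianNormMean n) atTop (nhds 1) := by
  have h := (tendsto_log_mul_sqrt_div_gaussianNormMean_sub_one.div_atTop
    tendsto_log_natCast).add_const 1
  rw [zero_add] at h
  refine h.congr' ?_
  filter_upwards [tendsto_log_natCast.eventually_gt_atTop 0] with n hn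
  rw [mul_div_cancel_left₀ _ hn.ne']
  ring

lemma tendsto_halfNormalMaxMean_div_maxScale :
    Tendsto (fun n => halfNormalMaxMean n / maxScale n) atTop (nhds 1) := by
  have h1 := (tendsto_maxScale_mul_halfNormalMaxMean_sub.div_atTop tendsto_maxScale).div_atTop
    tendsto_maxScale
  have h2 := tendsto_maxShift_div_maxScale.div_atTop tendsto_maxScale
  have h := (h1.sub h2).add_const 1
  rw [sub_zero, zero_add] at h
  refine h.congr' ?_
  filter_upwards [tendsto_maxScale.eventually_gt_atTop 0] with n hn
  field_simp
  ring

lemma meanWidth_crossPolytope_isLittleO :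
    (fun n : ℕ => meanWidth (crossPolytope n 1) -
        (2 * Real.sqrt (Real.log n / n) -
          (Real.log (Real.log n) + Real.log Real.pi - 2 * Real.eulerMascheroniConstant) /
            (2 * Real.sqrt (n * Real.log n))))
      =o[atTop] fun n : ℕ => 1 / Real.sqrt (n * Real.log n) := by
  -- With g = `gaussianNormMean n`, the error times √(n log n) splits into √2 times the normalized
  -- error of μ_n and √2 μ_n √(log n) (√n/g − 1).
  have h1 := halfNormalMaxMean_isLittleO.tendsto_div_nhds_zero.const_mul (Real.sqrt 2)
  have h2 := (tendsto_halfNormalMaxMean_div_maxScale.mul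
    tendsto_log_mul_sqrt_div_gaussianNormMean_sub_one).const_mul 2
  have h := h1.add h2
  rw [mul_zero, mul_zero, mul_zero, add_zero] at h
  refine isLittleO_of_tendsto' ?_ (h.congr' ?_)
  · filter_upwards [tendsto_log_natCast.eventually_gt_atTop 0, eventually_ge_atTop 1] with n hn hn1 h0
    have : (0 : ℝ) < n := by exact_mod_cast hn1
    exact absurd h0 (by positivity)
  · filter_upwards [tendsto_log_natCast.eventually_gt_atTop 0, eventually_ge_atTop 1] with n hL hn1
    have hn0 : (0 : ℝ) < n := by exact_mod_cast hn1
    rw [meanWidth_crossPolytope hn1 zero_le_one, maxScale, Real.sqrt_mul (by norm_num),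
      Real.sqrt_mul hn0.le, Real.sqrt_div hL.le]
    have e2 : Real.sqrt 2 ^ 2 = 2 := Real.sq_sqrt (by norm_num)
    have eL : Real.log n = Real.sqrt (Real.log n) ^ 2 := (Real.sq_sqrt hL.le).symm
    have hg := gaussianNormMean_pos n
    have hsL : 0 < Real.sqrt (Real.log n) := Real.sqrt_pos.2 hL
    have hsn : 0 < Real.sqrt n := Real.sqrt_pos.2 hn0
    have hs2 : 0 < Real.sqrt 2 := by positivity
    generalize Real.log (Real.log n) + Real.log Real.pi - 2 * Real.eulerMascheroniConstant = N
    generalize halfNormalMaxMean n = m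
    have e3 : Real.sqrt 2 * ((m - (Real.sqrt 2 * Real.sqrt (Real.log n) -
        N / (2 * (Real.sqrt 2 * Real.sqrt (Real.log n))))) / (1 / Real.sqrt (Real.log n))) =
        Real.sqrt 2 * m * Real.sqrt (Real.log n) - 2 * Real.sqrt (Real.log n) ^ 2 + N / 2 := by
      field_simp
      rw [e2]
      ring
    have e4 : 2 * (m / (Real.sqrt 2 * Real.sqrt (Real.log n)) *
        (Real.log n * (Real.sqrt n / gaussianNormMean n - 1))) =
        Real.sqrt 2 * m * Real.sqrt (Real.log n) * (Real.sqrt n / gaussianNormMean n - 1) := by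
      conv_lhs => rw [eL]
      rw [Real.sqrt_sq hsL.le]
      field_simp
      rw [e2, mul_comm 2]
    rw [e3, e4]
    field_simp
    ring

lemma meanWidth_inradius_normalized_isEquivalent :
    (fun n : ℕ => meanWidth ((inradius (crossPolytope n 1))⁻¹ • crossPolytope n 1))
      ~[atTop] fun n : ℕ => 2 * Real.sqrt (2 * Real.log n) := by
  refine isEquivalent_of_tendsto_one ?_
  have h := tendsto_halfNormalMaxMean_div_maxScale.mul tendsto_sqrt_div_gaussianNormMean
  rw [one_mul] at h
  refine h.congr' ?_
  filter_upwards [tendsto_maxScale.eventually_gt_atTop 0, eventually_ge_atTop 1] with n hb hn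
  simp only [Pi.div_apply]
  rw [meanWidth_inradius_normalized_crossPolytope hn, ← maxScale]
  field_simp

theorem mainTheorem5 :
    ((fun n : ℕ => halfNormalMaxMean n -
        (Real.sqrt (2 * Real.log n) -
          (Real.log (Real.log n) + Real.log Real.pi - 2 * Real.eulerMascheroniConstant) /
            (2 * Real.sqrt (2 * Real.log n))))
      =o[atTop] fun n : ℕ => 1 / Real.sqrt (Real.log n)) ∧
    ((fun n : ℕ => meanWidth (crossPolytope n 1) -
        (2 * Real.sqrt (Real.log n / n) -
          (Real.log (Real.log n) + Real.log Real.pi - 2 * Real.eulerMascheroniConstant) /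
            (2 * Real.sqrt (n * Real.log n))))
      =o[atTop] fun n : ℕ => 1 / Real.sqrt (n * Real.log n)) ∧
    ((fun n : ℕ => meanWidth ((inradius (crossPolytope n 1))⁻¹ • crossPolytope n 1))
      ~[atTop] fun n : ℕ => 2 * Real.sqrt (2 * Real.log n)) := by
  exact ⟨halfNormalMaxMean_isLittleO, meanWidth_crossPolytope_isLittleO,
    meanWidth_inradius_normalized_isEquivalent⟩
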